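/- **Setting.** Digraphs are finite. For a digraph $G=(V,E)$ and an edge $e$, $G\setminus e$ is $G$ with $e$ deleted, and $G^R$ is $G$ with all edges reversed. A strongly connected component (SCC) is a maximal strongly connected subgraph, identified with its vertex set. An edge of $G$ is a *strong bridge* if its deletion increases the number of SCCs. Let $G$ be strongly connected and fix a start vertex $s\in V$. A vertex $a$ *dominates* $x$ in $G_s$ if every path in $G$ from $s$ to $x$ contains $a$; the dominator tree $D$ of $G_s$ is the tree with root $s$ in which the parent of $x\neq s$ is its immediate dominator, i.e. the dominator of $x$, other than $x$, that is dominated by all dominators of $x$ other than $x$. $D(v)$ is the set of descendants of $v$ in $D$, including $v$. An edge $(u,v)$ is a *bridge of $G_s$* if every path in $G$ from $s$ to $v$ traverses $(u,v)$. Let $T$ be a depth-first search tree of $G$ with root $s$. For a vertex $x$, $\mathrm{loop}(x)$ is the set of descendants $y$ of $x$ in $T$ such that $G$ has a path from $y$ to $x$ containing only descendants of $x$ in $T$. In the loop nesting tree $H$ with respect to $T$, the parent $h(w)$ of a vertex $w\ne s$ is the nearest proper ancestor $x$ of $w$ in $T$ with $w\in\mathrm{loop}(x)$; $H(w)$ is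 the set of descendants of $w$ in $H$, including $w$. $D^R$, $D^R(u)$, $H^R$, $h^R$, $H^R(w)$ are the same notions for $G^R$ with start vertex $s$ and a depth-first search tree $T^R$ of $G^R$ with root $s$. An edge $e=(u,v)$ of $G$ is called a bridge of $G_s^R$ if all paths in $G^R$ from $s$ to $u$ traverse the reversed edge $(v,u)$. **Theorem.** Let $G=(V,E)$ be a strongly connected digraph, $s\in V$ arbitrary, $T$ and $T^R$ arbitrary depth-first search trees of $G$ and $G^R$ with root $s$, let $e=(u,v)$ be a strong bridge of $G$, and let $C$ be an SCC of $G\setminus e$. Then one of the following cases holds: (a) $e$ is a bridge of $G_s$ but not of $G_s^R$, and either $C\subseteq D(v)$ or $C=V\setminus D(v)$; (b) $e$ is a bridge of $G_s^R$ but not of $G_s$, and either $C\subseteq D^R(u)$ or $C=V\setminus D^R(u)$; (c) $e$ is a bridge of both $G_s$ and $G_s^R$, and either $C\subseteq D(v)\setminus D^R(u)$, or $C\subseteq D^R(u)\setminus D(v)$, or $C\subseteq D(v)\cap D^R(u)$, or $C=V\setminus(D(v)\cup D^R(u))$. Moreover, if $e$ is a bridge of $G_s$ and $C\subseteq D(v)$,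 then $C=H(w)$ for some $w\in D(v)$ with $h(w)\notin D(v)$. Likewise, if $e$ is a bridge of $G_s^R$ and $C\subseteq D^R(u)$, then $C=H^R(w)$ for some $w\in D^R(u)$ with $h^R(w)\notin D^R(u)$. -/

import Mathlib

namespace Digraph

variable {V : Type*}

/-- The reverse digraph, obtained by reversing the direction of all edges. -/
def reverse (G : Digraph V) : Digraph V where
  Adj x y := G.Adj y x

/-- The digraph `G ∖ (u, v)` obtained by deleting the edge `(u, v)`. -/
def deleteEdge (G : Digraph V) (u v : V) : Digraph V where
  Adj x y := G.Adj x y ∧ (x, y) ≠ (u, v)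

/-- `p` is the list of vertices of a directed path of `G` from `x` to `y`, in the order in which
they are visited. A path may have length zero, and need not be simple. -/
def IsPath (G : Digraph V) (x y : V) (p : List V) : Prop :=
  p.IsChain G.Adj ∧ p.head? = some x ∧ p.getLast? = some y

/-- The path with vertex list `p` traverses the edge `(u, v)`. -/
def Traverses (p : List V) (u v : V) : Prop :=
  [u, v] <:+: p

/-- There is a directed path from each vertex to every other vertex. -/
def IsStronglyConnected (G : Digraph V) : Prop :=
  ∀ x y : V, ∃ p, G.IsPath x y p

/-- The subgraph of `G` induced by the nonempty set `C` is strongly connected. -/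
def IsStronglyConnectedOn (G : Digraph V) (C : Set V) : Prop :=
  C.Nonempty ∧ ∀ x ∈ C, ∀ y ∈ C, ∃ p, G.IsPath x y p ∧ ∀ z ∈ p, z ∈ C

/-- `C` is the vertex set of a strongly connected component, i.e. of a maximal strongly connected
subgraph, of `G`. -/
def IsSCC (G : Digraph V) (C : Set V) : Prop :=
  Maximal G.IsStronglyConnectedOn C

/-- The edge `(u, v)` of `G` is a strong bridge: its removal increases the number of strongly
connected components. (To be used for finite `V`.) -/
def IsStrongBridge (G : Digraph V) (u v : V) : Prop :=
  G.Adj u v ∧ {C : Set V | G.IsSCC C}.ncard < {C : Set V | (G.deleteEdge u v).IsSCC C}.ncard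

/-- The edge `(u, v)` is a bridge of the flow graph `G` with start vertex `s`: all paths from `s`
to `v` include `(u, v)`. -/
def IsBridge (G : Digraph V) (s u v : V) : Prop :=
  G.Adj u v ∧ ∀ p, G.IsPath s v p → Traverses p u v

/-- `a` dominates `x` in the flow graph `G` with start vertex `s`. -/
def Dominates (G : Digraph V) (s a x : V) : Prop :=
  ∀ p, G.IsPath s x p → a ∈ p

/-- `a` is a proper dominator of `x`. -/
def ProperlyDominates (G : Digraph V) (s a x : V) : Prop :=
  G.Dominates s a x ∧ a ≠ x

/-- `d` is the immediate dominator of `x`, i.e. the parent of `x` in the dominator tree: the proper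
dominator of `x` that is dominated by all proper dominators of `x`. -/
def IsImmediateDominator (G : Digraph V) (s d x : V) : Prop :=
  G.ProperlyDominates s d x ∧ ∀ a, G.ProperlyDominates s a x → G.Dominates s a d

/-- `D(v)`: the descendants of `v` (including `v`) in the dominator tree `D` of the flow graph `G`
with start vertex `s`. -/
def domDescendants (G : Digraph V) (s v : V) : Set V :=
  {x | Relation.ReflTransGen (G.IsImmediateDominator s) v x}

/-- A depth-first search tree of `G` with root `s`, spanning all vertices, together with the
order `pre` in which the search discovers the vertices. The search always continues from the most
recently discovered vertex that still has an edge to an undiscovered vertex. -/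
structure DFSTree (G : Digraph V) (s : V) where
  /-- The preorder number, i.e. the time of discovery, of a vertex. -/
  pre : V → ℕ
  pre_injective : Function.Injective pre
  /-- The tree parent of a vertex. -/
  parent : V → Option V
  parent_root : parent s = none
  /-- Each `y ≠ s` is discovered along an edge `(x, y)` from its parent `x`, which is discovered
  before `y`; and at the time of discovery of `y`, no vertex `a` that was discovered after `x` has
  an edge to a vertex `b` that is still undiscovered. -/
  exists_parent : ∀ y, y ≠ s → ∃ x, parent y = some x ∧ G.Adj x y ∧ pre x < pre y ∧
    ∀ a b, pre x < pre a → pre a < pre y → G.Adj a b → pre b < pre y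

namespace DFSTree

variable {G : Digraph V} {s : V}

/-- `x` is an ancestor of `y` (possibly `y` itself) in the tree `T`. -/
def IsAncestor (T : DFSTree G s) (x y : V) : Prop :=
  Relation.ReflTransGen (fun a b => T.parent b = some a) x y

/-- `loop(u)`: the descendants `x` of `u` in `T` such that there is a path from `x` to `u` in `G`
containing only descendants of `u` in `T`. -/
def loop (T : DFSTree G s) (u : V) : Set V :=
  {x | T.IsAncestor u x ∧ ∃ p, G.IsPath x u p ∧ ∀ z ∈ p, T.IsAncestor u z}

/-- `u = h(x)`, i.e. `u` is the parent of `x` in the loop nesting forest with respect to `T`: the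
nearest proper ancestor `u` of `x` in `T` such that `x ∈ loop(u)`. -/
def IsLoopParent (T : DFSTree G s) (u x : V) : Prop :=
  (T.IsAncestor u x ∧ u ≠ x ∧ x ∈ T.loop u) ∧
    ∀ a, T.IsAncestor a x → a ≠ x → x ∈ T.loop a → T.IsAncestor a u

/-- `H(w)`: the descendants of `w` (including `w`) in the loop nesting forest with respect
to `T`. -/
def loopDescendants (T : DFSTree G s) (w : V) : Set V :=
  {x | Relation.ReflTransGen T.IsLoopParent w x}

end DFSTree

end Digraph

/-!
Deleting `e = (u, v)` from the strongly connected digraph `G` yields `G'`. Every claim is read off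
from reachability in `G'`.

If `e` is a bridge of `G_s`, then `D(v)` is the set of vertices that `s` does not reach in `G'`
(`IsBridge.mem_domDescendants_iff`), and reversing all edges, if `e` is a bridge of `G_s^R`, then
`D^R(u)` is the set of vertices that do not reach `s` in `G'`. If `e` is not a bridge of `G_s`,
then `s` still reaches everything in `G'`, and dually. A strongly connected component of `G'` is a
class of mutual reachability (`IsSCC.eq_mutuallyReachable`), so each of these two sets contains it
or is disjoint from it, and a component disjoint from both is the component of `s`. A strong bridge
is a bridge of one of the two flow graphs, since otherwise `G'` would be strongly connected.

For a component `C ⊆ D(v)`, let `w` be the vertex of `C` that the search discovers first. By the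
depth-first property (`DFSTree.isAncestor_of_adj`), `w` is an ancestor of all of `C`, so
`C ⊆ loop(w)`; and `loop(w) = H(w)` (`DFSTree.loopDescendants_eq_loop`). Conversely, the only edge
entering `D(v)` is `e`, which is a tree edge, so `u` is not a descendant of any vertex of `D(v)`.
Hence closed walks through a vertex `a` of `D(v)` among descendants of `a` never leave `D(v)` and
never use `e` (`IsBridge.reachable_of_mem_loop`), which gives `loop(w) ⊆ C`. The same fact, applied
to `h(w)`, shows that `h(w) ∈ D(v)` would put `h(w)` into `C`, against the choice of `w`.
-/

open Relation

namespace Digraph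

variable {V : Type*} {G : Digraph V} {s u v : V}

/-! ### Paths and reachability -/

/-- `y` can be reached from `x` in `G`. -/
def Reachable (G : Digraph V) : V → V → Prop :=
  ReflTransGen G.Adj

/-- `y` can be reached from `x` by a path of `G` all of whose vertices, ends included, lie
in `S`. -/
def ReachableIn (G : Digraph V) (S : Set V) (x y : V) : Prop :=
  x ∈ S ∧ ReflTransGen (fun a b => G.Adj a b ∧ b ∈ S) x y

theorem ReachableIn.trans {S : Set V} {x y z : V} (h₁ : G.ReachableIn S x y)
    (h₂ : G.ReachableIn S y z) : G.ReachableIn S x z :=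
  ⟨h₁.1, h₁.2.trans h₂.2⟩

theorem ReachableIn.mono {S S' : Set V} (hS : S ⊆ S') {x y : V} (h : G.ReachableIn S x y) :
    G.ReachableIn S' x y :=
  ⟨hS h.1, ReflTransGen.mono (fun _ _ hab => ⟨hab.1, hS hab.2⟩) _ _ h.2⟩

theorem ReachableIn.reachable {S : Set V} {x y : V} (h : G.ReachableIn S x y) :
    G.Reachable x y :=
  ReflTransGen.mono (fun _ _ hab => hab.1) _ _ h.2

theorem ReachableIn.tail {S : Set V} {x y z : V} (h : G.ReachableIn S x y) (hyz : G.Adj y z)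
    (hz : z ∈ S) : G.ReachableIn S x z :=
  ⟨h.1, ReflTransGen.tail h.2 ⟨hyz, hz⟩⟩

theorem exists_isChain_iff_reflTransGen {r : V → V → Prop} {x y : V} :
    (∃ p : List V, p.IsChain r ∧ p.head? = some x ∧ p.getLast? = some y) ↔
      ReflTransGen r x y := by
  constructor
  · rintro ⟨_ | ⟨a, l⟩, hc, hh, hl⟩
    · simp at hh
    · obtain rfl : a = x := by simpa using hh
      refine List.relationReflTransGen_of_exists_isChain_cons l hc ?_
      rw [List.getLast?_eq_some_getLast (List.cons_ne_nil _ _)] at hl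
      simpa using hl
  · intro h
    obtain ⟨l, hc, hl⟩ := List.exists_isChain_cons_of_relationReflTransGen h
    refine ⟨x :: l, hc, rfl, ?_⟩
    rw [List.getLast?_eq_some_getLast (List.cons_ne_nil _ _), hl]

theorem exists_isPath_iff {x y : V} : (∃ p, G.IsPath x y p) ↔ G.Reachable x y :=
  exists_isChain_iff_reflTransGen

theorem exists_isPath_subset_iff {S : Set V} {x y : V} :
    (∃ p, G.IsPath x y p ∧ ∀ z ∈ p, z ∈ S) ↔ G.ReachableIn S x y := by
  constructor
  · rintro ⟨p, ⟨hc, hh, hl⟩, hp⟩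
    refine ⟨hp x (List.mem_of_mem_head? hh), exists_isChain_iff_reflTransGen.1 ⟨p, ?_, hh, hl⟩⟩
    rw [List.isChain_iff_forall_rel_of_append_cons_cons] at hc ⊢
    rintro a b l₁ l₂ rfl
    exact ⟨hc rfl, hp b (by simp)⟩
  · rintro ⟨hx, h⟩
    obtain ⟨p, hc, hh, hl⟩ := exists_isChain_iff_reflTransGen.2 h
    refine ⟨p, ⟨hc.imp fun _ _ hab => hab.1, hh, hl⟩, ?_⟩
    refine hc.induction (· ∈ S) p (fun _ _ hab _ => hab.2) fun hne => ?_
    rw [List.head?_eq_some_head hne] at hh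
    rw [Option.some.inj hh]
    exact hx

theorem exists_isPath_not_traverses_iff {x y : V} :
    (∃ p, G.IsPath x y p ∧ ¬ Traverses p u v) ↔ (G.deleteEdge u v).Reachable x y := by
  rw [← exists_isPath_iff]
  refine exists_congr fun p => ?_
  constructor
  · rintro ⟨⟨hc, hh, hl⟩, hp⟩
    refine ⟨?_, hh, hl⟩
    rw [List.isChain_iff_forall_rel_of_append_cons_cons] at hc ⊢
    intro a b l₁ l₂ he
    refine ⟨hc he, fun hab => hp ?_⟩
    obtain ⟨rfl, rfl⟩ := Prod.mk.inj hab
    exact ⟨l₁, l₂, by simp [he]⟩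
  · rintro ⟨hc, hh, hl⟩
    refine ⟨⟨hc.imp fun _ _ hab => hab.1, hh, hl⟩, fun hp => ?_⟩
    have := hc.infix hp
    simp [deleteEdge] at this

theorem IsStronglyConnected.reachable (hG : G.IsStronglyConnected) (x y : V) : G.Reachable x y :=
  exists_isPath_iff.1 (hG x y)

theorem reverse_reachable {x y : V} : G.reverse.Reachable x y ↔ G.Reachable y x :=
  reflTransGen_swap

theorem IsStronglyConnected.reverse (hG : G.IsStronglyConnected) :
    G.reverse.IsStronglyConnected := fun x y =>
  exists_isPath_iff.2 (reverse_reachable.2 (hG.reachable y x))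

theorem reverse_deleteEdge : (G.deleteEdge u v).reverse = G.reverse.deleteEdge v u := by
  ext x y
  simp only [Digraph.reverse, deleteEdge, ne_eq, Prod.mk.injEq]
  tauto

/-! ### Strongly connected components -/

/-- The vertices on a path between two members of a class of mutual reachability belong to the
class. -/
theorem Reachable.reachableIn_mutuallyReachable {x a b : V} (h : G.Reachable a b)
    (ha : G.Reachable x a) (hb : G.Reachable b x) :
    G.ReachableIn {y | G.Reachable x y ∧ G.Reachable y x} a b := by
  refine ⟨⟨ha, h.trans hb⟩, ?_⟩
  induction h using ReflTransGen.head_induction_on with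
  | refl => exact .refl
  | @head a c hac hcb ih =>
    have hc : G.Reachable x c := ha.tail hac
    exact .head ⟨hac, hc, ReflTransGen.trans hcb hb⟩ (ih hc)

theorem isStronglyConnectedOn_mutuallyReachable (x : V) :
    G.IsStronglyConnectedOn {y | G.Reachable x y ∧ G.Reachable y x} :=
  ⟨⟨x, .refl, .refl⟩, fun _ ha _ hb => exists_isPath_subset_iff.2 <|
    Reachable.reachableIn_mutuallyReachable (ReflTransGen.trans ha.2 hb.1) ha.1 hb.2⟩

theorem IsSCC.reachableIn {C : Set V} (hC : G.IsSCC C) {x y : V} (hx : x ∈ C) (hy : y ∈ C) :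
    G.ReachableIn C x y :=
  exists_isPath_subset_iff.1 (hC.prop.2 x hx y hy)

theorem IsSCC.eq_mutuallyReachable {C : Set V} (hC : G.IsSCC C) {x : V} (hx : x ∈ C) :
    C = {y | G.Reachable x y ∧ G.Reachable y x} :=
  hC.eq_of_subset (isStronglyConnectedOn_mutuallyReachable x) fun _ hy =>
    ⟨(hC.reachableIn hx hy).reachable, (hC.reachableIn hy hx).reachable⟩

theorem IsStronglyConnected.isSCC_univ [Nonempty V] (hG : G.IsStronglyConnected) :
    G.IsSCC Set.univ :=
  ⟨⟨Set.univ_nonempty, fun x _ y _ => (hG x y).imp fun _ hp => ⟨hp, fun _ _ => trivial⟩⟩,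
    fun _ _ _ => Set.subset_univ _⟩

theorem IsStronglyConnected.setOf_isSCC [Nonempty V] (hG : G.IsStronglyConnected) :
    {C | G.IsSCC C} = {Set.univ} := by
  ext C
  refine ⟨fun hC => ?_, ?_⟩
  · exact hC.eq_of_subset hG.isSCC_univ.prop (Set.subset_univ C)
  · rintro rfl
    exact hG.isSCC_univ

theorem IsStronglyConnectedOn.reverse {C : Set V} (hC : G.IsStronglyConnectedOn C) :
    G.reverse.IsStronglyConnectedOn C := by
  refine ⟨hC.1, fun x hx y hy => ?_⟩
  obtain ⟨p, ⟨hc, hh, hl⟩, hp⟩ := hC.2 y hy x hx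
  exact ⟨p.reverse, ⟨List.isChain_reverse.2 hc, by simpa using hl, by simpa using hh⟩, by simpa⟩

theorem IsSCC.reverse {C : Set V} (hC : G.IsSCC C) : G.reverse.IsSCC C :=
  ⟨hC.prop.reverse, fun _ hC' hle => hC.le_of_ge hC'.reverse hle⟩

/-! ### Dominators -/

theorem dominates_iff {a x : V} : G.Dominates s a x ↔ ¬ G.ReachableIn {z | z ≠ a} s x := by
  rw [← exists_isPath_subset_iff, Dominates]
  push Not
  refine forall₂_congr fun p _ => ?_
  simp

theorem dominates_refl (x : V) : G.Dominates s x x := fun _ hp =>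
  List.mem_of_getLast? hp.2.2

theorem Dominates.trans {a b x : V} (hab : G.Dominates s a b) (hbx : G.Dominates s b x) :
    G.Dominates s a x := by
  intro p hp
  -- The part of `p` up to a visit of `b` already visits `a`.
  obtain ⟨l₁, l₂, rfl⟩ := List.append_of_mem (hbx p hp)
  have h : G.IsPath s b (l₁ ++ [b]) := by
    have he : l₁ ++ b :: l₂ = (l₁ ++ [b]) ++ l₂ := by simp
    refine ⟨(he ▸ hp.1).left_of_append, ?_, by simp⟩
    have := hp.2.1
    cases l₁ <;> simpa using this
  have := hab _ h
  grind

theorem Dominates.antisymm {a b : V} (hb : G.Reachable s b) (hab : G.Dominates s a b)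
    (hba : G.Dominates s b a) : a = b := by
  by_contra hne
  rw [dominates_iff] at hab hba
  -- No path from `s` visits `a` or `b`: the part up to the first of the two would avoid the other.
  have key : ∀ x, G.Reachable s x → G.ReachableIn {z | z ≠ a ∧ z ≠ b} s x := by
    intro x hx
    induction hx with
    | refl =>
      refine ⟨⟨?_, ?_⟩, .refl⟩
      · rintro rfl
        exact hba ⟨hne, .refl⟩
      · rintro rfl
        exact hab ⟨Ne.symm hne, .refl⟩
    | @tail y z _ hyz ih =>
      refine ih.tail hyz ⟨?_, ?_⟩
      · rintro rfl
        exact hba ((ih.mono fun _ h => h.2).tail hyz hne)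
      · rintro rfl
        exact hab ((ih.mono fun _ h => h.1).tail hyz (Ne.symm hne))
  exact hab ((key b hb).mono fun _ h => h.1)

theorem Dominates.total {a b x : V} (hx : G.Reachable s x) (ha : G.Dominates s a x)
    (hb : G.Dominates s b x) : G.Dominates s a b ∨ G.Dominates s b a := by
  by_contra hcon
  rw [not_or, dominates_iff, dominates_iff, not_not, not_not] at hcon
  obtain ⟨hab, hba⟩ := hcon
  -- The last visit of `a` or `b` on a path decides which of the two can be bypassed: a path ending
  -- with a visit of `a` is replaced by one to `a` that avoids `b`, and vice versa.
  have key : ∀ y, G.Reachable s y →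
      G.ReachableIn {z | z ≠ a} s y ∨ G.ReachableIn {z | z ≠ b} s y := by
    intro y hy
    induction hy with
    | refl => exact .inl ⟨hab.1, .refl⟩
    | @tail y z _ hyz ih =>
      by_cases hza : z = a
      · exact .inr (hza ▸ hba)
      by_cases hzb : z = b
      · exact .inl (hzb ▸ hab)
      exact ih.imp (fun h => h.tail hyz hza) fun h => h.tail hyz hzb
  exact (key x hx).elim (dominates_iff.1 ha) (dominates_iff.1 hb)

/-- The proper dominator of `x` with the most dominators is the immediate dominator, because the
dominators of `x` form a chain. -/
theorem exists_isImmediateDominator [Finite V] {a x : V} (hx : G.Reachable s x)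
    (ha : G.ProperlyDominates s a x) : ∃ d, G.IsImmediateDominator s d x := by
  obtain ⟨d, hd, hmax⟩ := Set.exists_max_image {d | G.ProperlyDominates s d x}
    (fun d => {c | G.Dominates s c d}.ncard) (Set.toFinite _) ⟨a, ha⟩
  refine ⟨d, hd, fun b hb => ?_⟩
  rcases hb.1.total hx hd.1 with h | h
  · exact h
  · have he : {c | G.Dominates s c d} = {c | G.Dominates s c b} :=
      Set.eq_of_subset_of_ncard_le (fun c hc => Dominates.trans hc h) (hmax b hb)
    have : b ∈ {c | G.Dominates s c b} := dominates_refl b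
    rwa [← he] at this

theorem mem_domDescendants_iff [Finite V] (hG : G.IsStronglyConnected) {a x : V} :
    x ∈ G.domDescendants s a ↔ G.Dominates s a x := by
  constructor
  · intro h
    induction h with
    | refl => exact dominates_refl a
    | tail _ h ih => exact ih.trans h.1.1
  · induction hn : {c | G.Dominates s c x}.ncard using Nat.strong_induction_on generalizing x with
    | _ n ih =>
      intro hax
      by_cases hne : a = x
      · exact hne ▸ ReflTransGen.refl
      obtain ⟨d, hd⟩ := exists_isImmediateDominator (hG.reachable s x) ⟨hax, hne⟩
      refine ReflTransGen.tail (ih _ ?_ rfl (hd.2 a ⟨hax, hne⟩)) hd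
      rw [← hn]
      refine Set.ncard_lt_ncard ⟨fun c hc => Dominates.trans hc hd.1.1, fun hle => hd.1.2 ?_⟩
      exact hd.1.1.antisymm (hG.reachable s x) (hle (dominates_refl x))

/-! ### Bridges of a flow graph -/

theorem isBridge_iff (huv : G.Adj u v) :
    G.IsBridge s u v ↔ ¬ (G.deleteEdge u v).Reachable s v := by
  rw [← exists_isPath_not_traverses_iff, IsBridge]
  push Not
  exact and_iff_right huv

theorem reachable_deleteEdge_of_not_isBridge (hG : G.IsStronglyConnected) (huv : G.Adj u v)
    (h : ¬ G.IsBridge s u v) (x : V) : (G.deleteEdge u v).Reachable s x := by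
  rw [isBridge_iff huv, not_not] at h
  induction hG.reachable s x with
  | refl => exact .refl
  | @tail y z _ hyz ih =>
    by_cases he : (y, z) = (u, v)
    · exact (Prod.mk.inj he).2 ▸ h
    · exact ih.tail ⟨hyz, he⟩

/-- If `s` did not reach `u` in `G ∖ (u, v)`, then no path from `s` in `G` could use the edge
`(u, v)`, and `s` would not reach `u` in `G` either. -/
theorem reachable_deleteEdge_left (hG : G.IsStronglyConnected) :
    (G.deleteEdge u v).Reachable s u := by
  by_contra hu
  have key : ∀ x, G.Reachable s x → (G.deleteEdge u v).Reachable s x := by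
    intro x hx
    induction hx with
    | refl => exact .refl
    | @tail y z _ hyz ih =>
      refine ih.tail ⟨hyz, fun he => hu ?_⟩
      exact (Prod.mk.inj he).1 ▸ ih
  exact hu (key u (hG.reachable s u))

theorem IsBridge.mem_domDescendants_iff [Finite V] (hG : G.IsStronglyConnected)
    (hb : G.IsBridge s u v) {x : V} :
    x ∈ G.domDescendants s v ↔ ¬ (G.deleteEdge u v).Reachable s x := by
  rw [Digraph.mem_domDescendants_iff hG, ← exists_isPath_not_traverses_iff]
  push Not
  constructor
  · intro hx p hp
    by_contra hnt
    -- The part of `p` up to a visit of `v` still traverses `(u, v)`.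
    obtain ⟨l₁, l₂, rfl⟩ := List.append_of_mem (hx p hp)
    have he : l₁ ++ v :: l₂ = (l₁ ++ [v]) ++ l₂ := by simp
    have h : G.IsPath s v (l₁ ++ [v]) := by
      refine ⟨(he ▸ hp.1).left_of_append, ?_, by simp⟩
      have := hp.2.1
      cases l₁ <;> simpa using this
    exact hnt (he ▸ (hb.2 _ h).trans (List.prefix_append _ _).isInfix)
  · intro hx p hp
    exact (hx p hp).subset (by simp)

theorem IsBridge.left_notMem [Finite V] (hG : G.IsStronglyConnected) (hb : G.IsBridge s u v) :
    u ∉ G.domDescendants s v := fun h =>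
  (hb.mem_domDescendants_iff hG).1 h (reachable_deleteEdge_left hG)

theorem IsBridge.root_notMem [Finite V] (hG : G.IsStronglyConnected) (hb : G.IsBridge s u v) :
    s ∉ G.domDescendants s v := fun h =>
  (hb.mem_domDescendants_iff hG).1 h .refl

/-- The only edge that enters `D(v)` is the bridge `(u, v)`. -/
theorem IsBridge.eq_of_adj [Finite V] (hG : G.IsStronglyConnected) (hb : G.IsBridge s u v)
    {a b : V} (hab : G.Adj a b) (ha : a ∉ G.domDescendants s v) (hbv : b ∈ G.domDescendants s v) :
    a = u ∧ b = v := by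
  rw [hb.mem_domDescendants_iff hG] at ha hbv
  rw [not_not] at ha
  by_contra hne
  exact hbv (ha.tail ⟨hab, fun he => hne (Prod.mk.inj he)⟩)

/-! ### Depth-first search trees -/

namespace DFSTree

variable (T : DFSTree G s)

theorem exists_parent_of_ne {y : V} (hy : y ≠ s) :
    ∃ x, T.parent y = some x ∧ G.Adj x y ∧ T.pre x < T.pre y :=
  let ⟨x, h₁, h₂, h₃, _⟩ := T.exists_parent y hy
  ⟨x, h₁, h₂, h₃⟩

variable {T}

theorem adj_of_parent {x y : V} (h : T.parent y = some x) : G.Adj x y ∧ T.pre x < T.pre y := by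
  have hy : y ≠ s := by
    intro hy
    rw [hy, T.parent_root] at h
    cases h
  obtain ⟨x', hx', hadj, hlt⟩ := T.exists_parent_of_ne hy
  obtain rfl : x = x' := Option.some.inj (h.symm.trans hx')
  exact ⟨hadj, hlt⟩

theorem IsAncestor.pre_le {x y : V} (h : T.IsAncestor x y) : T.pre x ≤ T.pre y := by
  induction h with
  | refl => exact le_rfl
  | tail _ h ih => exact ih.trans (adj_of_parent h).2.le

theorem isAncestor_root (x : V) : T.IsAncestor s x := by
  induction hn : T.pre x using Nat.strong_induction_on generalizing x with
  | _ n ih =>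
    by_cases hx : x = s
    · rw [hx]
      exact .refl
    · obtain ⟨y, hp, -, hlt⟩ := T.exists_parent_of_ne hx
      exact (ih _ (hn ▸ hlt) y rfl).tail hp

/-- All vertices discovered after `a`, up to a vertex `b` that is an out-neighbour of `a`, are
descendants of `a`, since the search does not backtrack from `a` before `b` is discovered. -/
theorem isAncestor_of_adj {a b c : V} (hab : G.Adj a b) (hac : T.pre a ≤ T.pre c)
    (hcb : T.pre c ≤ T.pre b) : T.IsAncestor a c := by
  induction hn : T.pre c using Nat.strong_induction_on generalizing c with
  | _ n ih =>
    rcases hac.eq_or_lt with h | hlt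
    · exact T.pre_injective h ▸ .refl
    have hc : c ≠ s := by
      rintro rfl
      exact hlt.not_ge (isAncestor_root a).pre_le
    obtain ⟨x, hp, -, hxc, hx⟩ := T.exists_parent c hc
    refine ReflTransGen.tail (ih _ (hn ▸ hxc) ?_ (hxc.le.trans hcb) rfl) hp
    by_contra! hxa
    exact (hx a b hxa hlt hab).not_ge hcb

/-- The descendants of a vertex are discovered consecutively. -/
theorem IsAncestor.of_pre_le {w c y : V} (h : T.IsAncestor w y) (hwc : T.pre w ≤ T.pre c)
    (hcy : T.pre c ≤ T.pre y) : T.IsAncestor w c := by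
  induction h with
  | refl => exact T.pre_injective (le_antisymm hwc hcy) ▸ .refl
  | @tail y' y hw hp ih =>
    rcases le_total (T.pre c) (T.pre y') with hle | hle
    · exact ih hle
    · exact ReflTransGen.trans hw (isAncestor_of_adj (adj_of_parent hp).1 hle hcy)

/-- A path all of whose vertices are discovered no earlier than its first vertex `w` stays among
the descendants of `w`. -/
theorem isAncestor_of_reachableIn {w x : V}
    (h : G.ReachableIn {z | T.pre w ≤ T.pre z} w x) : T.IsAncestor w x := by
  obtain ⟨-, h⟩ := h
  induction h with
  | refl => exact .refl
  | @tail y z _ hyz ih =>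
    rcases le_total (T.pre z) (T.pre y) with hle | hle
    · exact ih.of_pre_le hyz.2 hle
    · exact ReflTransGen.trans ih (isAncestor_of_adj hyz.1 hle le_rfl)

theorem IsAncestor.reachableIn {w x y : V} (hwx : T.IsAncestor w x) (hxy : T.IsAncestor x y) :
    G.ReachableIn {z | T.IsAncestor w z} x y := by
  induction hxy with
  | refl => exact ⟨hwx, .refl⟩
  | tail hxy hp ih => exact ih.tail (adj_of_parent hp).1 ((ReflTransGen.trans hwx hxy).tail hp)

/-! ### Loops and the loop nesting tree -/

theorem mem_loop_iff {w x : V} : x ∈ T.loop w ↔ G.ReachableIn {z | T.IsAncestor w z} x w := by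
  rw [← exists_isPath_subset_iff]
  refine and_iff_right_of_imp ?_
  rintro ⟨p, hp, h⟩
  exact h x (List.mem_of_mem_head? hp.2.1)

theorem loop_trans {w x y : V} (hx : x ∈ T.loop w) (hy : y ∈ T.loop x) : y ∈ T.loop w := by
  have hwx := hx.1
  rw [mem_loop_iff] at *
  exact (hy.mono fun _ hz => ReflTransGen.trans hwx hz).trans hx

theorem exists_isLoopParent [Finite V] {w x : V} (hne : w ≠ x) (hx : x ∈ T.loop w) :
    ∃ h, T.IsLoopParent h x := by
  obtain ⟨h, hh, hmax⟩ := Set.exists_max_image {a | a ≠ x ∧ x ∈ T.loop a} T.pre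
    (Set.toFinite _) ⟨w, hne, hx⟩
  exact ⟨h, ⟨hh.2.1, hh⟩, fun a ha hax hxa =>
    ha.of_pre_le (hmax a ⟨hax, hxa⟩) hh.2.1.pre_le⟩

theorem loopDescendants_eq_loop [Finite V] (w : V) : T.loopDescendants w = T.loop w := by
  ext x
  constructor
  · intro hx
    induction hx with
    | refl => exact mem_loop_iff.2 ⟨.refl, .refl⟩
    | tail _ h ih => exact loop_trans ih h.1.2.2
  · induction hn : T.pre x using Nat.strong_induction_on generalizing x with
    | _ n ih =>
      intro hx
      by_cases hne : w = x
      · exact hne ▸ ReflTransGen.refl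
      obtain ⟨h, hh⟩ := exists_isLoopParent hne hx
      have hwh : T.IsAncestor w h := hh.2 w hx.1 hne hx
      have hlt : T.pre h < T.pre x :=
        hh.1.1.pre_le.lt_of_ne fun he => hh.1.2.1 (T.pre_injective he)
      refine ReflTransGen.tail (ih _ (hn ▸ hlt) h rfl ?_) hh
      exact mem_loop_iff.2 ((hwh.reachableIn hh.1.1).trans (mem_loop_iff.1 hx))

end DFSTree

/-! ### Components inside the dominator subtree of a bridge -/

section Bridge

variable [Finite V] {T : DFSTree G s}

/-- The tree path from `s` to a vertex of `D(v)` enters `D(v)` through the bridge `(u, v)`. -/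
theorem IsBridge.pre_left_lt (hG : G.IsStronglyConnected) (hb : G.IsBridge s u v) {x : V}
    (hx : x ∈ G.domDescendants s v) : T.pre u < T.pre x := by
  induction T.isAncestor_root x with
  | refl => exact absurd hx (hb.root_notMem hG)
  | @tail y z _ hp ih =>
    obtain ⟨hyz, hlt⟩ := DFSTree.adj_of_parent hp
    by_cases hy : y ∈ G.domDescendants s v
    · exact (ih hy).trans hlt
    · exact (hb.eq_of_adj hG hyz hy hx).1 ▸ hlt

/-- Among the descendants of a vertex `w` of `D(v)`, no edge enters `D(v)` from outside: its tail
would be `u`, which is discovered before `w`. So paths into `D(v)` among these descendants never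
leave `D(v)`. -/
theorem IsBridge.reachable_deleteEdge_of_reachableIn (hG : G.IsStronglyConnected)
    (hb : G.IsBridge s u v) {w a b : V} (hw : w ∈ G.domDescendants s v)
    (h : G.ReachableIn {z | T.IsAncestor w z} a b) (hbv : b ∈ G.domDescendants s v) :
    a ∈ G.domDescendants s v ∧ (G.deleteEdge u v).Reachable a b := by
  obtain ⟨ha, h⟩ := h
  induction h using ReflTransGen.head_induction_on with
  | refl => exact ⟨hbv, .refl⟩
  | @head a c hac _ ih =>
    obtain ⟨hc, hcb⟩ := ih hac.2
    have hau : a ≠ u := by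
      rintro rfl
      exact (hb.pre_left_lt (T := T) hG hw).not_ge (DFSTree.IsAncestor.pre_le ha)
    refine ⟨?_, .head ⟨hac.1, fun he => hau (Prod.mk.inj he).1⟩ hcb⟩
    by_contra hna
    exact hau (hb.eq_of_adj hG hac.1 hna hc).1

theorem IsBridge.reachable_of_mem_loop (hG : G.IsStronglyConnected) (hb : G.IsBridge s u v)
    {w x : V} (hw : w ∈ G.domDescendants s v) (hx : x ∈ T.loop w) :
    (G.deleteEdge u v).Reachable w x ∧ (G.deleteEdge u v).Reachable x w := by
  obtain ⟨hxv, hxw⟩ :=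
    hb.reachable_deleteEdge_of_reachableIn hG hw (DFSTree.mem_loop_iff.1 hx) hw
  have hwx := DFSTree.IsAncestor.reachableIn .refl hx.1
  exact ⟨(hb.reachable_deleteEdge_of_reachableIn hG hw hwx hxv).2, hxw⟩

theorem IsBridge.exists_eq_loopDescendants (hG : G.IsStronglyConnected) (hb : G.IsBridge s u v)
    (T : DFSTree G s) {C : Set V} (hC : (G.deleteEdge u v).IsSCC C)
    (hCv : C ⊆ G.domDescendants s v) :
    ∃ w ∈ G.domDescendants s v,
      (∃ h, T.IsLoopParent h w ∧ h ∉ G.domDescendants s v) ∧ C = T.loopDescendants w := by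
  obtain ⟨w, hw, hmin⟩ := Set.exists_min_image C T.pre (Set.toFinite _) hC.prop.1
  have hCw := hC.eq_mutuallyReachable hw
  have hin : ∀ {x y}, x ∈ C → y ∈ C → G.ReachableIn C x y := fun hx hy =>
    let h := hC.reachableIn hx hy
    ⟨h.1, ReflTransGen.mono (fun _ _ hab => ⟨hab.1.1, hab.2⟩) _ _ h.2⟩
  have hanc : C ⊆ {z | T.IsAncestor w z} := fun x hx =>
    DFSTree.isAncestor_of_reachableIn ((hin hw hx).mono hmin)
  refine ⟨w, hCv hw, ?_, ?_⟩
  · have hsw : s ≠ w := by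
      rintro rfl
      exact hb.root_notMem hG (hCv hw)
    have hs : w ∈ T.loop s := by
      refine DFSTree.mem_loop_iff.2 ⟨T.isAncestor_root w, ?_⟩
      exact ReflTransGen.mono (fun _ b hab => ⟨hab, T.isAncestor_root b⟩) _ _ (hG.reachable w s)
    obtain ⟨h, hh⟩ := DFSTree.exists_isLoopParent hsw hs
    refine ⟨h, hh, fun hhv => hh.1.2.1 (T.pre_injective ?_)⟩
    have hhC : h ∈ C := by
      rw [hCw]
      exact (hb.reachable_of_mem_loop hG hhv hh.1.2.2).symm
    exact le_antisymm hh.1.1.pre_le (hmin h hhC)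
  · rw [DFSTree.loopDescendants_eq_loop]
    refine Set.Subset.antisymm
      (fun x hx => DFSTree.mem_loop_iff.2 ((hin hx hw).mono hanc)) fun x hx => ?_
    rw [hCw]
    exact hb.reachable_of_mem_loop hG (hCv hw) hx

end Bridge

/-! ### The components of the digraph without the edge -/

theorem IsSCC.forall_not_reachable_or_forall_reachable {C : Set V} (hC : G.IsSCC C) (s : V) :
    (∀ x ∈ C, ¬ G.Reachable s x) ∨ ∀ x ∈ C, G.Reachable s x := by
  by_contra! h
  obtain ⟨⟨x, hx, hsx⟩, y, hy, hsy⟩ := h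
  exact hsy (hsx.trans (hC.reachableIn hx hy).reachable)

end Digraph

open Digraph

theorem mainTheorem1 {V : Type*} [Finite V] (G : Digraph V) (hG : G.IsStronglyConnected)
    (s : V) (T : Digraph.DFSTree G s) (TR : Digraph.DFSTree G.reverse s)
    (u v : V) (he : G.IsStrongBridge u v)
    (C : Set V) (hC : (G.deleteEdge u v).IsSCC C) :
    ((G.IsBridge s u v ∧ ¬ G.reverse.IsBridge s v u ∧
        (C ⊆ G.domDescendants s v ∨ C = Set.univ \ G.domDescendants s v)) ∨
      (¬ G.IsBridge s u v ∧ G.reverse.IsBridge s v u ∧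
        (C ⊆ G.reverse.domDescendants s u ∨ C = Set.univ \ G.reverse.domDescendants s u)) ∨
      (G.IsBridge s u v ∧ G.reverse.IsBridge s v u ∧
        (C ⊆ G.domDescendants s v \ G.reverse.domDescendants s u ∨
          C ⊆ G.reverse.domDescendants s u \ G.domDescendants s v ∨
          C ⊆ G.domDescendants s v ∩ G.reverse.domDescendants s u ∨
          C = Set.univ \ (G.domDescendants s v ∪ G.reverse.domDescendants s u)))) ∧
    (G.IsBridge s u v → C ⊆ G.domDescendants s v →
      ∃ w ∈ G.domDescendants s v,
        (∃ h, T.IsLoopParent h w ∧ h ∉ G.domDescendants s v) ∧ C = T.loopDescendants w) ∧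
    (G.reverse.IsBridge s v u → C ⊆ G.reverse.domDescendants s u →
      ∃ w ∈ G.reverse.domDescendants s u,
        (∃ h, TR.IsLoopParent h w ∧ h ∉ G.reverse.domDescendants s u) ∧
          C = TR.loopDescendants w) := by
  have hG' := hG.reverse
  have huv := he.1
  have hvu : G.reverse.Adj v u := huv
  have hC' : (G.reverse.deleteEdge v u).IsSCC C := reverse_deleteEdge ▸ hC.reverse
  have hrev {x y : V} :
      (G.reverse.deleteEdge v u).Reachable x y ↔ (G.deleteEdge u v).Reachable y x := by
    rw [← reverse_deleteEdge, reverse_reachable]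
  refine ⟨?_, fun hb hCv => hb.exists_eq_loopDescendants hG T hC hCv,
    fun hb hCu => hb.exists_eq_loopDescendants hG' TR hC' hCu⟩
  have hD (hb : G.IsBridge s u v) (x : V) := hb.mem_domDescendants_iff hG (x := x)
  have hDR (hb : G.reverse.IsBridge s v u) (x : V) := hb.mem_domDescendants_iff hG' (x := x)
  have hN (hb : ¬ G.IsBridge s u v) := reachable_deleteEdge_of_not_isBridge hG huv hb
  have hNR (hb : ¬ G.reverse.IsBridge s v u) := reachable_deleteEdge_of_not_isBridge hG' hvu hb
  simp only [hrev] at hDR hNR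
  have hbr : G.IsBridge s u v ∨ G.reverse.IsBridge s v u := by
    by_contra! hno
    have : Nonempty V := ⟨s⟩
    have hsc : (G.deleteEdge u v).IsStronglyConnected := fun x y =>
      exists_isPath_iff.2 (ReflTransGen.trans (hNR hno.2 x) (hN hno.1 y))
    have := he.2
    simp [hG.setOf_isSCC, hsc.setOf_isSCC] at this
  have hcase := hC.forall_not_reachable_or_forall_reachable s
  have hcaseR := hC'.forall_not_reachable_or_forall_reachable s
  simp only [hrev] at hcaseR
  -- A component that meets neither set of cut-off vertices is the component of `s`.
  have hCs (h₁ : ∀ x ∈ C, (G.deleteEdge u v).Reachable s x)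
      (h₂ : ∀ x ∈ C, (G.deleteEdge u v).Reachable x s) (x : V) :
      x ∈ C ↔ (G.deleteEdge u v).Reachable s x ∧ (G.deleteEdge u v).Reachable x s := by
    obtain ⟨y, hy⟩ := hC.prop.1
    have hs : s ∈ C := by
      rw [hC.eq_mutuallyReachable hy]
      exact ⟨h₂ y hy, h₁ y hy⟩
    exact Set.ext_iff.1 (hC.eq_mutuallyReachable hs) x
  by_cases hb : G.IsBridge s u v <;> by_cases hbR : G.reverse.IsBridge s v u
  · refine .inr (.inr ⟨hb, hbR, ?_⟩)
    rcases hcase with h₁ | h₁ <;> rcases hcaseR with h₂ | h₂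
    · exact .inr (.inr (.inl fun x hx => ⟨(hD hb x).2 (h₁ x hx), (hDR hbR x).2 (h₂ x hx)⟩))
    · exact .inl fun x hx => ⟨(hD hb x).2 (h₁ x hx), fun h => (hDR hbR x).1 h (h₂ x hx)⟩
    · exact .inr (.inl fun x hx => ⟨(hDR hbR x).2 (h₂ x hx), fun h => (hD hb x).1 h (h₁ x hx)⟩)
    · refine .inr (.inr (.inr (Set.ext fun x => ?_)))
      simp [hCs h₁ h₂, hD hb, hDR hbR]
  · refine .inl ⟨hb, hbR,
      hcase.imp (fun h x hx => (hD hb x).2 (h x hx)) fun h => Set.ext fun x => ?_⟩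
    simp [hCs h fun x _ => hNR hbR x, hD hb, hNR hbR]
  · refine .inr (.inl ⟨hb, hbR,
      hcaseR.imp (fun h x hx => (hDR hbR x).2 (h x hx)) fun h => Set.ext fun x => ?_⟩)
    simp [hCs (fun x _ => hN hb x) h, hDR hbR, hN hb]
  · exact absurd hbr (by simp [hb, hbR])
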